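/- Let $J$ and $H$ be discrete groups with $H$ non-amenable. Let $\bigoplus_H J$ be the group of finitely supported functions $H\to J$, on which $H$ acts by translation, $(h\cdot f)(x)=f(h^{-1}x)$, and let $G=J\wr H=\bigl(\bigoplus_H J\bigr)\rtimes H$ be the wreath product, containing $H$ as a subgroup. The group $G$ acts on the set $\bigoplus_H J\cong G/H$, with $\bigoplus_H J$ acting by left multiplication and $H$ by translation, and hence on the Stone–Čech compactification $\beta\bigl(\bigoplus_H J\bigr)$ of this discrete set. An affine $G$-flow is a compact convex subset $K$ of a locally convex Hausdorff real topological vector space, with an action of $G$ on $K$ by continuous affine maps; $G$-morphisms are $G$-equivariant continuous affine maps. An affine $G$-flow $K$ is $(G,H)$-irreducible if it has an $H$-fixed point and no proper closed convex $G$-invariant subset of $K$ contains an $H$-fixed point. Let $\Delta(G,H)$ be the universal $(G,H)$-irreducible affine flow, that is, the one that admits a $G$-morphism onto every $(G,H)$-irreducible affine flow; it exists and is unique up to unique isomorphism. Let the Furstenberg boundary $\partial(G,H)=\mathrm{Ext}(\Delta(G,H))$ be its set of extremal points, with the induced topology and $G$-action. Then there is a $G$-equivariant homeomorphism $$\partial(J\wr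 H,\,H)\;\cong\;\beta\Bigl(\bigoplus_H J\Bigr).$$ -/

import Mathlib

universe u v w

/-- A discrete group `H` is amenable: there is a left-invariant finitely additive probability
measure defined on all subsets of `H`. -/
def IsAmenableGroup (H : Type u) [Group H] : Prop :=
  ∃ μ : Set H → ℝ, (∀ A, 0 ≤ μ A) ∧ μ Set.univ = 1 ∧
    (∀ A B, Disjoint A B → μ (A ∪ B) = μ A + μ B) ∧
    ∀ (h : H) (A : Set H), μ ((fun x => h * x) '' A) = μ A

/-- A map between subsets of real vector spaces that preserves convex combinations. -/
def PreservesConvexComb {V : Type*} {W : Type*} [AddCommGroup V] [Module ℝ V] [AddCommGroup W]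
    [Module ℝ W] {K : Set V} {L : Set W} (f : K → L) : Prop :=
  ∀ (x y z : K) (a b : ℝ), 0 ≤ a → 0 ≤ b → a + b = 1 →
    (z : V) = a • (x : V) + b • (y : V) → (f z : W) = a • (f x : W) + b • (f y : W)

/-- An affine `G`-flow for a discrete group `G`: a compact convex subset of some locally convex
Hausdorff real topological vector space, with an action of `G` by continuous affine maps. -/
structure AffineFlow (G : Type u) [Group G] where
  /-- the ambient locally convex space -/
  V : Type w
  [addCommGroup : AddCommGroup V]
  [module : Module ℝ V]
  [topologicalSpace : TopologicalSpace V]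
  [isTopologicalAddGroup : IsTopologicalAddGroup V]
  [continuousSMul : ContinuousSMul ℝ V]
  [locallyConvexSpace : LocallyConvexSpace ℝ V]
  [t2Space : T2Space V]
  /-- the compact convex set -/
  carrier : Set V
  convex : Convex ℝ carrier
  isCompact : IsCompact carrier
  [mulAction : MulAction G carrier]
  continuous_act : ∀ g : G, Continuous (fun x : carrier => g • x)
  affine_act : ∀ g : G, PreservesConvexComb (fun x : carrier => g • x)

attribute [instance] AffineFlow.addCommGroup AffineFlow.module AffineFlow.topologicalSpace
  AffineFlow.isTopologicalAddGroup AffineFlow.continuousSMul AffineFlow.locallyConvexSpace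
  AffineFlow.t2Space AffineFlow.mulAction

namespace AffineFlow

variable {G : Type u} [Group G]

/-- The points of the flow fixed by the subgroup `H`. -/
def fixedBy (K : AffineFlow.{u, w} G) (H : Subgroup G) : Set K.carrier :=
  {x | ∀ h ∈ H, h • x = x}

/-- A `G`-morphism: a `G`-equivariant continuous affine map. -/
def IsMorphism (K : AffineFlow.{u, v} G) (L : AffineFlow.{u, w} G)
    (f : K.carrier → L.carrier) : Prop :=
  Continuous f ∧ PreservesConvexComb f ∧ ∀ (g : G) (x : K.carrier), f (g • x) = g • f x

/-- `K` is a `(G, H)`-irreducible affine flow: it has an `H`-fixed point, and every closed convex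
`G`-invariant subset of `K` that contains an `H`-fixed point is all of `K`. -/
def IsIrreducible (K : AffineFlow.{u, w} G) (H : Subgroup G) : Prop :=
  (K.fixedBy H).Nonempty ∧
    ∀ L : Set K.carrier, IsClosed L → Convex ℝ ((fun x : K.carrier => (x : K.V)) '' L) →
      (∀ (g : G), ∀ x ∈ L, g • x ∈ L) → (L ∩ K.fixedBy H).Nonempty → L = Set.univ

/-- `K` is the universal `(G, H)`-irreducible affine flow `Δ(G, H)`: it is irreducible and has a
`G`-morphism onto every `(G, H)`-irreducible affine flow. -/
def IsUniversal (K : AffineFlow.{u, w} G) (H : Subgroup G) : Prop :=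
  K.IsIrreducible H ∧ ∀ L : AffineFlow.{u, w} G, L.IsIrreducible H →
    ∃ f : K.carrier → L.carrier, IsMorphism K L f ∧ Function.Surjective f

/-- The set of extremal points of an affine flow, as a subspace of the flow. For
`K = Δ(G, H)` this is the Furstenberg boundary `∂(G, H)`. -/
def ext (K : AffineFlow.{u, w} G) : Set K.carrier :=
  {x | (x : K.V) ∈ K.carrier.extremePoints ℝ}

theorem smul_mem_ext (K : AffineFlow.{u, w} G) (g : G) {x : K.carrier} (hx : x ∈ K.ext) :
    g • x ∈ K.ext := by
  refine ⟨(g • x).2, ?_⟩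
  rintro y hy z hz ⟨a, b, ha, hb, hab, h⟩
  have key := K.affine_act g⁻¹ ⟨y, hy⟩ ⟨z, hz⟩ (g • x) a b ha.le hb.le hab h.symm
  simp only [inv_smul_smul] at key
  have h1 := hx.2 (g⁻¹ • (⟨y, hy⟩ : K.carrier)).2 (g⁻¹ • (⟨z, hz⟩ : K.carrier)).2
    ⟨a, b, ha, hb, hab, key.symm⟩
  have h2 : g⁻¹ • (⟨y, hy⟩ : K.carrier) = x := Subtype.ext h1
  rw [← h2, smul_inv_smul]

/-- The restriction of the `G`-action to the set of extremal points. -/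
instance (K : AffineFlow.{u, w} G) : MulAction G K.ext where
  smul g x := ⟨g • (x : K.carrier), K.smul_mem_ext g x.2⟩
  one_smul x := Subtype.ext (one_smul G (x : K.carrier))
  mul_smul g h x := Subtype.ext (mul_smul g h (x : K.carrier))

end AffineFlow

/-- The Stone–Čech compactification `β X` of a set `X` (a discrete space). -/
def Beta (X : Type u) : Type u := @StoneCech X ⊥

namespace Beta

noncomputable section

instance (X : Type u) : TopologicalSpace (Beta X) :=
  @instTopologicalSpaceStoneCech X ⊥

instance (X : Type u) : CompactSpace (Beta X) :=
  @instCompactSpaceStoneCech X ⊥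

instance (X : Type u) : T2Space (Beta X) :=
  @instT2SpaceStoneCech X ⊥

/-- The canonical map `X → β X`. -/
def unit {X : Type u} (x : X) : Beta X := @stoneCechUnit X ⊥ x

/-- The continuous extension to `β X` of an arbitrary map from `X` to a compact Hausdorff space. -/
def extend {X : Type u} {Y : Type v} [TopologicalSpace Y] [CompactSpace Y] [T2Space Y]
    (f : X → Y) : Beta X → Y :=
  @stoneCechExtend X ⊥ Y _ _ f continuous_bot _

theorem continuous_extend {X : Type u} {Y : Type v} [TopologicalSpace Y] [CompactSpace Y]
    [T2Space Y] (f : X → Y) : Continuous (extend f) :=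
  @continuous_stoneCechExtend X ⊥ Y _ _ f continuous_bot _

theorem extend_unit {X : Type u} {Y : Type v} [TopologicalSpace Y] [CompactSpace Y]
    [T2Space Y] (f : X → Y) (x : X) : extend f (unit x) = f x :=
  @stoneCechExtend_stoneCechUnit X ⊥ Y _ _ f continuous_bot _ x

theorem hom_ext {X : Type u} {Y : Type v} [TopologicalSpace Y] [T2Space Y] {f g : Beta X → Y}
    (hf : Continuous f) (hg : Continuous g) (h : ∀ x, f (unit x) = g (unit x)) : f = g :=
  @stoneCech_hom_ext X ⊥ Y _ _ f g hf hg (funext h)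

/-- The extension `β X → β X` of a map `X → X`. -/
def map {X : Type u} (f : X → X) : Beta X → Beta X := extend (fun x => unit (f x))

theorem map_unit {X : Type u} (f : X → X) (x : X) : map f (unit x) = unit (f x) :=
  extend_unit _ x

theorem continuous_map {X : Type u} (f : X → X) : Continuous (map f) := continuous_extend _

theorem map_id {X : Type u} : map (fun x : X => x) = id :=
  hom_ext (continuous_map _) continuous_id fun x => map_unit _ x

theorem map_comp {X : Type u} (f g : X → X) : map (fun x => f (g x)) = map f ∘ map g :=
  hom_ext (continuous_map _) ((continuous_map _).comp (continuous_map _)) fun x => by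
    rw [Function.comp_apply, map_unit, map_unit, map_unit]

/-- The action of `G` on `β X` that extends an action of `G` on the set `X`: each `g` acts by the
continuous extension of `x ↦ g • x`. -/
instance {G : Type v} [Group G] {X : Type u} [MulAction G X] : MulAction G (Beta X) where
  smul g := map (fun x => g • x)
  one_smul p := by
    change map (fun x => (1 : G) • x) p = p
    simp only [one_smul, map_id, id]
  mul_smul g h p := by
    change map (fun x => (g * h) • x) p = map (fun x => g • x) (map (fun x => h • x) p)
    simp only [mul_smul, map_comp (fun x : X => g • x) (fun x => h • x), Function.comp_apply]

theorem smul_unit {G : Type v} [Group G] {X : Type u} [MulAction G X] (g : G) (x : X) :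
    g • (unit x : Beta X) = unit (g • x) :=
  map_unit _ x

theorem continuous_smul {G : Type v} [Group G] {X : Type u} [MulAction G X] (g : G) :
    Continuous (fun p : Beta X => g • p) :=
  continuous_map _

end

end Beta

/-- The restricted product `⊕_H J`: the group, under pointwise multiplication, of functions
`H → J` that are trivial outside a finite set. -/
def RestrictedPower (J : Type u) (H : Type v) [Group J] : Subgroup (H → J) where
  carrier := {f | (Function.mulSupport f).Finite}
  one_mem' := by simp
  mul_mem' := fun {f g} hf hg => (hf.union hg).subset (Function.mulSupport_mul f g)
  inv_mem' := fun {f} hf => by simpa using hf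

/-- The left-translation action of `H` on `⊕_H J` by automorphisms: `(h · f) x = f (h⁻¹ x)`. -/
def shiftAut (J : Type u) (H : Type v) [Group J] [Group H] :
    H →* MulAut (RestrictedPower J H) where
  toFun h :=
    { toFun := fun f => ⟨fun x => f.1 (h⁻¹ * x), by
        have := f.2.preimage (f := fun x => h⁻¹ * x) (mul_right_injective h⁻¹).injOn
        exact this⟩
      invFun := fun f => ⟨fun x => f.1 (h * x), by
        have := f.2.preimage (f := fun x => h * x) (mul_right_injective h).injOn
        exact this⟩
      left_inv := fun f => Subtype.ext (by funext x; simp)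
      right_inv := fun f => Subtype.ext (by funext x; simp)
      map_mul' := fun f g => rfl }
  map_one' := by
    ext f x
    simp
  map_mul' h k := by
    ext f x
    simp [mul_assoc]

/-- The (restricted) wreath product `J ≀ H = (⊕_H J) ⋊ H`. -/
abbrev WreathProduct (J : Type u) (H : Type v) [Group J] [Group H] : Type (max u v) :=
  RestrictedPower J H ⋊[shiftAut J H] H

/-- The copy of `H` in `J ≀ H`. -/
def WreathProduct.base (J : Type u) (H : Type v) [Group J] [Group H] :
    Subgroup (WreathProduct J H) :=
  (SemidirectProduct.inr : H →* WreathProduct J H).range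

/-- The action of `J ≀ H` on the set `⊕_H J`, which is the coset space `(J ≀ H) / H`:
`⊕_H J` acts by left multiplication and `H` acts by translation. -/
instance WreathProduct.instMulAction (J : Type u) (H : Type v) [Group J] [Group H] :
    MulAction (WreathProduct J H) (RestrictedPower J H) where
  smul g f := g.left * shiftAut J H g.right f
  one_smul f := by
    change (1 : WreathProduct J H).left * shiftAut J H (1 : WreathProduct J H).right f = f
    simp
  mul_smul g k f := by
    change (g * k).left * shiftAut J H (g * k).right f =
      g.left * shiftAut J H g.right (k.left * shiftAut J H k.right f)
    simp [mul_assoc]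

-- `Δ(G, H)` is realised as the space `M` of finitely additive probability measures on `⊕_H J =
-- G/H`. Point masses have dense convex hull in `M`, and every map from the set to a compact convex
-- `L` extends to a continuous affine map `M → L` (`exists_extension`). Hence `M` maps to any flow
-- with an `H`-fixed point `l`, by extending `f ↦ f • l`.
--
-- Non-amenability enters once, to show that `δ_1` is the only `H`-fixed point of `M`
-- (`eq_dirac_one_of_shift_invariant`). Each `f ≠ 1` has a nonempty finite support, and the uniform
-- measure on it depends equivariantly on `f`; an invariant measure charging `{1}ᶜ` would thus
-- average to an invariant mean on `H`. As the orbit of `δ_1` contains all point masses, `M` is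
-- irreducible, hence universal, and any irreducible flow mapping to `M` is isomorphic to it.
--
-- The extremal points of `M` are the 0-1 valued measures, that is, the ultrafilters, which form
-- `β(⊕_H J)`.

universe w'

/-! ### Finitely additive probability measures and density of point masses -/

/-- The finitely additive probability measures defined on all subsets of `Y`, as a subset of a
product of lines. -/
def finAddProb (Y : Type u) : Set (ULift.{w} (Set Y) → ℝ) :=
  {μ | (∀ A, 0 ≤ μ A) ∧ μ ⟨Set.univ⟩ = 1 ∧
    ∀ A B : Set Y, Disjoint A B → μ ⟨A ∪ B⟩ = μ ⟨A⟩ + μ ⟨B⟩}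

namespace finAddProb

variable {Y : Type u} {Z : Type v}

theorem apply_empty (μ : finAddProb.{u, w} Y) : μ.1 ⟨∅⟩ = 0 := by
  have := μ.2.2.2 ∅ ∅ (by simp)
  simp only [Set.union_self] at this
  linarith

theorem apply_mono (μ : finAddProb.{u, w} Y) {A B : Set Y} (h : A ⊆ B) :
    μ.1 ⟨A⟩ ≤ μ.1 ⟨B⟩ := by
  have := μ.2.2.2 A (B \ A) Set.disjoint_sdiff_right
  rw [Set.union_sdiff_cancel h] at this
  linarith [μ.2.1 ⟨B \ A⟩]

theorem apply_le_one (μ : finAddProb.{u, w} Y) (A : Set Y) : μ.1 ⟨A⟩ ≤ 1 :=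
  (apply_mono μ (Set.subset_univ A)).trans_eq μ.2.2.1

theorem apply_compl (μ : finAddProb.{u, w} Y) (A : Set Y) : μ.1 ⟨Aᶜ⟩ = 1 - μ.1 ⟨A⟩ := by
  have := μ.2.2.2 A Aᶜ disjoint_compl_right
  rw [Set.union_compl_self, μ.2.2.1] at this
  linarith

theorem apply_preimage_finset (μ : finAddProb.{u, w} Y) (p : Y → Z) (T : Finset Z) :
    μ.1 ⟨p ⁻¹' T⟩ = ∑ t ∈ T, μ.1 ⟨p ⁻¹' {t}⟩ := by
  classical
  induction T using Finset.induction_on with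
  | empty => simp [apply_empty μ]
  | insert a s ha ih =>
    rw [Finset.sum_insert ha, ← ih, Finset.coe_insert, Set.insert_eq, Set.preimage_union,
      μ.2.2.2]
    exact Disjoint.preimage p (by simpa using ha)

theorem isClosed (Y : Type u) : IsClosed (finAddProb.{u, w} Y) := by
  refine IsClosed.inter (s₁ := {μ : ULift.{w} (Set Y) → ℝ | ∀ A, 0 ≤ μ A}) ?_ (IsClosed.inter ?_ ?_)
  · simp only [Set.ofPred_forall]
    exact isClosed_iInter fun A => isClosed_le continuous_const (continuous_apply A)
  · exact isClosed_eq (continuous_apply _) continuous_const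
  · change IsClosed {μ : ULift.{w} (Set Y) → ℝ | ∀ A B : Set Y, Disjoint A B →
      μ ⟨A ∪ B⟩ = μ ⟨A⟩ + μ ⟨B⟩}
    simp only [Set.ofPred_forall]
    exact isClosed_iInter fun A => isClosed_iInter fun B => isClosed_iInter fun _ =>
      isClosed_eq (by fun_prop) (by fun_prop)

theorem isCompact (Y : Type u) : IsCompact (finAddProb.{u, w} Y) := by
  refine (isCompact_univ_pi fun _ => isCompact_Icc (a := (0 : ℝ)) (b := 1)).of_isClosed_subset
    (isClosed Y) fun μ hμ A _ => ⟨hμ.1 A, apply_le_one ⟨μ, hμ⟩ A.down⟩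

instance (Y : Type u) : CompactSpace (finAddProb.{u, w} Y) :=
  isCompact_iff_compactSpace.1 (isCompact Y)

theorem convex (Y : Type u) : Convex ℝ (finAddProb.{u, w} Y) := by
  intro μ hμ ν hν a b ha hb hab
  refine ⟨fun A => ?_, ?_, fun A B h => ?_⟩
  · have := hμ.1 A
    have := hν.1 A
    simp only [Pi.add_apply, Pi.smul_apply, smul_eq_mul]
    positivity
  · simp [hμ.2.1, hν.2.1, hab]
  · simp only [Pi.add_apply, Pi.smul_apply, smul_eq_mul, hμ.2.2 A B h, hν.2.2 A B h]
    ring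

/-- The point mass at `y`. -/
noncomputable def dirac (y : Y) : finAddProb.{u, w} Y :=
  ⟨fun A => A.down.indicator (fun _ => (1 : ℝ)) y, fun A => Set.indicator_nonneg (by simp) y,
    by simp, fun A B h => by
      change (A ∪ B).indicator (fun _ => (1 : ℝ)) y = _
      rw [Set.indicator_union_of_disjoint h]⟩

theorem dirac_apply (y : Y) (A : Set Y) :
    (dirac.{u, w} y).1 ⟨A⟩ = A.indicator (fun _ => (1 : ℝ)) y := rfl

/-- The pushforward of a finitely additive measure. -/
def push (e : Y → Z) (μ : finAddProb.{u, w} Y) : finAddProb.{v, w} Z :=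
  ⟨fun A => μ.1 ⟨e ⁻¹' A.down⟩, fun A => μ.2.1 _, by simpa using μ.2.2.1, fun A B h => by
    simpa using μ.2.2.2 _ _ (h.preimage e)⟩

theorem push_apply (e : Y → Z) (μ : finAddProb.{u, w} Y) (A : Set Z) :
    (push e μ).1 ⟨A⟩ = μ.1 ⟨e ⁻¹' A⟩ := rfl

theorem continuous_eval (A : Set Y) : Continuous fun μ : finAddProb.{u, w} Y => μ.1 ⟨A⟩ :=
  (continuous_apply (⟨A⟩ : ULift.{w} (Set Y))).comp continuous_subtype_val

theorem continuous_push (e : Y → Z) : Continuous (push.{u, v, w} e) :=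
  Continuous.subtype_mk (f := fun (μ : finAddProb.{u, w} Y) (A : ULift.{w} (Set Z)) =>
    μ.1 ⟨e ⁻¹' A.down⟩) (continuous_pi fun A => continuous_eval (e ⁻¹' A.down))
    fun μ => (push e μ).2

theorem push_dirac (e : Y → Z) (y : Y) : push.{u, v, w} e (dirac y) = dirac (e y) := rfl

theorem preservesConvexComb_push (e : Y → Z) : PreservesConvexComb (push.{u, v, w} e) := by
  intro x y z a b _ _ _ h
  funext A
  exact congrFun h ⟨e ⁻¹' A.down⟩

/-- A basic neighbourhood in the product topology restricts only finitely many coordinates. -/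
theorem mem_closure_of_forall_finset {ι : Type*} {D : Set (ι → ℝ)} {μ : ι → ℝ}
    (h : ∀ I : Finset ι, ∃ d ∈ D, ∀ i ∈ I, d i = μ i) : μ ∈ closure D := by
  rw [mem_closure_iff]
  intro o ho hμ
  obtain ⟨I, U, hU, hsub⟩ := isOpen_pi_iff.1 ho μ hμ
  obtain ⟨d, hd, hI⟩ := h I
  refine ⟨d, hsub fun i hi => ?_, hd⟩
  rw [hI i hi]
  exact (hU i hi).2

/-- A finitely additive measure agrees on any finite family of sets with a finite convex
combination of point masses. -/
theorem exists_mem_convexHull (μ : finAddProb.{u, w} Y) (I : Finset (ULift.{w} (Set Y))) :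
    ∃ d ∈ convexHull ℝ (Set.range fun y : Y => (dirac.{u, w} y).1), ∀ A ∈ I, d A = μ.1 A := by
  classical
  have hY : Nonempty Y := by
    by_contra hY
    rw [not_nonempty_iff] at hY
    have h1 := μ.2.2.1
    rw [Set.univ_eq_empty_iff.2 hY, apply_empty μ] at h1
    norm_num at h1
  -- The fibres of `p` are the atoms of the algebra generated by `I`; `s` picks a point in each
  -- nonempty atom, and the mass of the atom is moved there.
  let p : Y → (I → Prop) := fun y A => y ∈ A.1.down
  let s : (I → Prop) → Y := Function.invFun p
  have hs : ∀ y, p (s (p y)) = p y := fun y => Function.invFun_eq ⟨y, rfl⟩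
  refine ⟨∑ t : I → Prop, μ.1 ⟨p ⁻¹' {t}⟩ • (dirac.{u, w} (s t)).1, ?_, ?_⟩
  · refine (convex_convexHull ℝ _).sum_mem (fun t _ => μ.2.1 _) ?_
      fun t _ => subset_convexHull ℝ _ ⟨s t, rfl⟩
    rw [← apply_preimage_finset]
    simpa using μ.2.2.1
  · intro A hA
    have h1 : A = ⟨p ⁻¹' (Finset.univ.filter fun t : I → Prop => t ⟨A, hA⟩ : Finset _)⟩ := by
      ext y
      simp [p]
    conv_rhs => rw [h1]
    rw [apply_preimage_finset, Finset.sum_filter, Finset.sum_apply]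
    refine Finset.sum_congr rfl fun t _ => ?_
    rw [Pi.smul_apply, smul_eq_mul]
    -- For an empty atom `s t` is a junk value, harmless because its weight is zero.
    by_cases ht : ∃ y, p y = t
    · obtain ⟨y, rfl⟩ := ht
      have h2 : s (p y) ∈ A.down ↔ p y ⟨A, hA⟩ := by
        rw [← hs y]
        simp only [hs]
        exact Iff.of_eq (congrFun (hs y) ⟨A, hA⟩)
      change _ * A.down.indicator (fun _ => (1 : ℝ)) (s (p y)) = _
      rw [Set.indicator_apply]
      simp only [h2]
      split_ifs <;> simp
    · have h0 : p ⁻¹' {t} = ∅ := by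
        ext y
        simpa using fun h => ht ⟨y, h⟩
      simp [h0, apply_empty μ]

theorem subset_of_dirac_mem {D : Set (ULift.{w} (Set Y) → ℝ)} (hD : IsClosed D)
    (hconv : Convex ℝ D) (h : ∀ y : Y, (dirac.{u, w} y).1 ∈ D) : finAddProb.{u, w} Y ⊆ D := by
  intro μ hμ
  have h1 := mem_closure_of_forall_finset (exists_mem_convexHull ⟨μ, hμ⟩)
  refine closure_minimal (convexHull_min ?_ hconv) hD h1
  rintro _ ⟨y, rfl⟩
  exact h y

theorem eq_univ_of_dirac_mem {C : Set (finAddProb.{u, w} Y)} (hC : IsClosed C)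
    (hconv : Convex ℝ ((fun x : finAddProb.{u, w} Y => x.1) '' C))
    (h : ∀ y : Y, dirac y ∈ C) : C = Set.univ := by
  have hD := (isClosed.{u, w} Y).isClosedEmbedding_subtypeVal.isClosedMap C hC
  refine Set.eq_univ_of_forall fun μ => ?_
  obtain ⟨ν, hν, he⟩ := subset_of_dirac_mem hD hconv (fun y => ⟨_, h y, rfl⟩) μ.2
  rwa [← Subtype.ext he]

/-- Continuous affine maps are determined by their values at the point masses. -/
theorem hom_ext {V : Type*} [AddCommGroup V] [Module ℝ V] [TopologicalSpace V] [T2Space V]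
    {L : Set V} {E F : finAddProb.{u, w} Y → L} (hE : Continuous E) (hF : Continuous F)
    (hE' : PreservesConvexComb E) (hF' : PreservesConvexComb F)
    (h : ∀ y, E (dirac y) = F (dirac y)) : E = F := by
  have : {μ | E μ = F μ} = Set.univ := by
    refine eq_univ_of_dirac_mem (isClosed_eq hE hF) ?_ h
    rintro _ ⟨x, hx, rfl⟩ _ ⟨y, hy, rfl⟩ a b ha hb hab
    refine ⟨⟨_, convex Y x.2 y.2 ha hb hab⟩, Subtype.ext ?_, rfl⟩
    rw [hE' x y _ a b ha hb hab rfl, hF' x y _ a b ha hb hab rfl, hx, hy]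
  exact funext fun μ => Set.eq_univ_iff_forall.1 this μ

/-! ### Barycenters: affine extension from point masses -/

section Extension

variable {V : Type*} [AddCommGroup V] [Module ℝ V] [TopologicalSpace V]

/-- A continuous functional is approximated along the closed convex hull of the graph of `φ` by
integrals of a step function. -/
theorem exists_step_approx {L : Set V} (hL : IsCompact L) (φ : Y → L) (l : V →L[ℝ] ℝ) {ε : ℝ}
    (hε : 0 < ε) : ∃ S : (ULift.{w} (Set Y) → ℝ) → ℝ, ∀ z ∈ closure (convexHull ℝ
      (Set.range fun y => ((dirac.{u, w} y).1, (φ y : V)))), |l z.2 - S z.1| ≤ ε := by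
  obtain ⟨M, hM⟩ := hL.exists_bound_of_continuousOn l.continuous.continuousOn
  -- Rounding `l ∘ φ` down to the grid `ε ℤ` gives a step function, with finitely many values since
  -- `l` is bounded on `L`; `S` integrates it.
  let q : Y → ℤ := fun y => ⌊l (φ y) / ε⌋
  let T : Finset ℤ := Finset.Icc ⌊-M / ε⌋ ⌊M / ε⌋
  have hq : ∀ y, q y ∈ T := by
    intro y
    have h1 := abs_le.1 (hM _ (φ y).2)
    exact Finset.mem_Icc.2 ⟨Int.floor_mono (by gcongr; exact h1.1),
      Int.floor_mono (by gcongr; exact h1.2)⟩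
  let S : (ULift.{w} (Set Y) → ℝ) →L[ℝ] ℝ :=
    ∑ n ∈ T, (n * ε : ℝ) • ContinuousLinearMap.proj ⟨q ⁻¹' {n}⟩
  let Λ : (ULift.{w} (Set Y) → ℝ) × V →L[ℝ] ℝ :=
    l.comp (ContinuousLinearMap.snd ℝ _ _) - S.comp (ContinuousLinearMap.fst ℝ _ _)
  refine ⟨S, fun z hz => ?_⟩
  -- The slab `|Λ| ≤ ε` is closed and convex, so it suffices to check the points of the graph of
  -- `φ`.
  have hcl : IsClosed (Λ ⁻¹' Set.Icc (-ε) ε) := isClosed_Icc.preimage Λ.continuous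
  have hcv : Convex ℝ (Λ ⁻¹' Set.Icc (-ε) ε) :=
    (convex_Icc (-ε) ε).linear_preimage Λ.toLinearMap
  have key := closure_minimal (convexHull_min ?_ hcv) hcl hz
  · exact abs_le.2 key
  rintro _ ⟨y, rfl⟩
  have hS : S (dirac.{u, w} y).1 = q y * ε := by
    simp only [S, sum_apply, smul_apply,
      ContinuousLinearMap.proj_apply, dirac_apply, smul_eq_mul]
    rw [Finset.sum_eq_single_of_mem (q y) (hq y)]
    · simp
    · intro n _ hn
      rw [Set.indicator_of_notMem (by simpa using hn.symm), mul_zero]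
  have h1 := Int.floor_le (l (φ y) / ε)
  have h2 := Int.lt_floor_add_one (l (φ y) / ε)
  rw [le_div_iff₀ hε] at h1
  rw [div_lt_iff₀ hε] at h2
  change l (φ y) - S (dirac.{u, w} y).1 ∈ Set.Icc (-ε) ε
  rw [hS]
  constructor <;> simp only [q] <;> linarith

variable [IsTopologicalAddGroup V] [ContinuousSMul ℝ V] [LocallyConvexSpace ℝ V] [T2Space V]

/-- A map to a compact convex set extends to a continuous affine map on finitely additive
probability measures: the barycenter of the image measure. -/
theorem exists_extension {L : Set V} (hL : IsCompact L) (hconv : Convex ℝ L) (φ : Y → L) :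
    ∃ E : finAddProb.{u, w} Y → L, Continuous E ∧ PreservesConvexComb E ∧
      ∀ y, E (dirac y) = φ y := by
  -- `closure R` is going to be the graph of the extension: compact, convex, and single-valued by
  -- `huniq`.
  let R := convexHull ℝ (Set.range fun y => ((dirac.{u, w} y).1, (φ y : V)))
  have hRsub : closure R ⊆ finAddProb.{u, w} Y ×ˢ L := by
    refine closure_minimal (convexHull_min ?_ ((convex Y).prod hconv))
      ((isClosed Y).prod hL.isClosed)
    rintro _ ⟨y, rfl⟩
    exact ⟨(dirac y).2, (φ y).2⟩
  have hRcv : Convex ℝ (closure R) := (convex_convexHull ℝ _).closure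
  have hRcomp : IsCompact (closure R) :=
    ((isCompact Y).prod hL).of_isClosed_subset isClosed_closure hRsub
  have hdir : ∀ y, ((dirac.{u, w} y).1, (φ y : V)) ∈ closure R := fun y =>
    subset_closure (subset_convexHull ℝ _ ⟨y, rfl⟩)
  have hex : ∀ μ : finAddProb.{u, w} Y, ∃ l : L, (μ.1, l.1) ∈ closure R := by
    intro μ
    have h1 : finAddProb.{u, w} Y ⊆ Prod.fst '' closure R := by
      refine subset_of_dirac_mem (hRcomp.image continuous_fst).isClosed
        (hRcv.is_linear_image (IsLinearMap.mk (fun _ _ => rfl) fun _ _ => rfl)) ?_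
      exact fun y => ⟨_, hdir y, rfl⟩
    obtain ⟨⟨ν, l⟩, hz, rfl⟩ := h1 μ.2
    exact ⟨⟨l, (hRsub hz).2⟩, hz⟩
  have huniq : ∀ (μ : ULift.{w} (Set Y) → ℝ) (l l' : V), (μ, l) ∈ closure R →
      (μ, l') ∈ closure R → l = l' := by
    intro μ l l' h h'
    by_contra hne
    obtain ⟨f, hf⟩ := geometric_hahn_banach_point_point hne
    -- `S μ` lies within a third of the gap of both `f l` and `f l'`, which is impossible.
    obtain ⟨S, hS⟩ := exists_step_approx.{u, w} hL φ f (ε := (f l' - f l) / 3) (by linarith)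
    have h1 := abs_le.1 (hS _ h)
    have h2 := abs_le.1 (hS _ h')
    dsimp only at h1 h2
    linarith [h1.1, h2.2]
  choose E hE using hex
  refine ⟨E, ?_, ?_, fun y => Subtype.ext (huniq _ _ _ (hE _) (hdir y))⟩
  -- Closed graph argument: the preimage of `C` is the projection of a compact piece of the graph.
  · refine continuous_iff_isClosed.2 fun C hC => ?_
    have hC' := (hC.trans hL.isClosed).preimage
      (continuous_snd (X := ULift.{w} (Set Y) → ℝ))
    convert (((hRcomp.inter_right hC').image continuous_fst).isClosed.preimage
      (continuous_subtype_val : Continuous fun μ : finAddProb.{u, w} Y => μ.1)) using 1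
    ext μ
    constructor
    · exact fun h => ⟨_, ⟨hE μ, _, h, rfl⟩, rfl⟩
    · rintro ⟨⟨ν, l⟩, ⟨hz, l', hl', h⟩, rfl⟩
      obtain rfl : l'.1 = l := h
      change E μ ∈ C
      rwa [Subtype.ext (huniq _ _ _ (hE μ) hz)]
  · intro x y z a b ha hb hab h
    refine huniq _ _ _ (hE z) ?_
    rw [h]
    exact hRcv (hE x) (hE y) ha hb hab

end Extension

end finAddProb

/-! ### Extremal points and the Stone–Čech compactification -/

namespace finAddProb

section Beta

variable {Y : Type u}

theorem mem_extremePoints_iff (μ : finAddProb.{u, w} Y) :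
    μ.1 ∈ (finAddProb.{u, w} Y).extremePoints ℝ ↔ ∀ A : Set Y, μ.1 ⟨A⟩ = 0 ∨ μ.1 ⟨A⟩ = 1 := by
  constructor
  · intro hμ A
    by_contra! hA
    have h0 : 0 < μ.1 ⟨A⟩ := lt_of_le_of_ne (μ.2.1 _) hA.1.symm
    have h1 : 0 < μ.1 ⟨Aᶜ⟩ := by
      rw [apply_compl, sub_pos]
      exact lt_of_le_of_ne (apply_le_one μ A) hA.2
    -- If `0 < μ A < 1`, then `μ` is a proper convex combination of its conditionings on `A` and
    -- `Aᶜ`, so by extremality it equals the former, which gives `A` mass 1.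
    have hcond : ∀ C : Set Y, 0 < μ.1 ⟨C⟩ →
        (fun B : ULift.{w} (Set Y) => μ.1 ⟨B.down ∩ C⟩ / μ.1 ⟨C⟩) ∈ finAddProb.{u, w} Y := by
      intro C hC
      refine ⟨fun B => div_nonneg (μ.2.1 _) hC.le, ?_, fun B B' h => ?_⟩
      · simp [hC.ne']
      · simp only [Set.union_inter_distrib_right]
        rw [μ.2.2.2 _ _ (h.mono Set.inter_subset_left Set.inter_subset_left), add_div]
    have h2 := hμ.2 (hcond A h0) (hcond Aᶜ h1) ⟨μ.1 ⟨A⟩, μ.1 ⟨Aᶜ⟩, h0, h1,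
      by rw [apply_compl]; ring, ?_⟩
    · have h3 := congrFun h2 ⟨A⟩
      simp only [Set.inter_self, div_self h0.ne'] at h3
      exact hA.2 h3.symm
    · funext B
      simp only [Pi.add_apply, Pi.smul_apply, smul_eq_mul]
      rw [mul_div_cancel₀ _ h0.ne', mul_div_cancel₀ _ h1.ne', ← μ.2.2.2]
      · rw [Set.inter_union_compl]
      · exact disjoint_compl_right.mono Set.inter_subset_right Set.inter_subset_right
  · intro h
    refine ⟨μ.2, ?_⟩
    rintro ν hν ν' hν' ⟨a, b, ha, hb, hab, he⟩
    funext ⟨A⟩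
    have h1 := congrFun he ⟨A⟩
    simp only [Pi.add_apply, Pi.smul_apply, smul_eq_mul] at h1
    have h2 := hν.1 ⟨A⟩
    have h3 := hν'.1 ⟨A⟩
    have h4 := apply_le_one ⟨ν, hν⟩ A
    have h5 := apply_le_one ⟨ν', hν'⟩ A
    dsimp only at h4 h5
    rcases h A with h0 | h0 <;> rw [h0] at h1 ⊢ <;> nlinarith

/-- The point of the space of finitely additive probability measures that corresponds to a point
of the Stone–Čech compactification. -/
noncomputable def ofBeta : Beta Y → finAddProb.{u, w} Y := Beta.extend dirac

theorem continuous_ofBeta : Continuous (ofBeta.{u, w} (Y := Y)) := Beta.continuous_extend _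

theorem ofBeta_unit (y : Y) : ofBeta.{u, w} (Beta.unit y) = dirac y := Beta.extend_unit _ _

theorem denseRange_unit : DenseRange (Beta.unit : Y → Beta Y) :=
  @denseRange_stoneCechUnit Y ⊥

theorem ofBeta_apply_eq_zero_or_one (p : Beta Y) (A : Set Y) :
    (ofBeta.{u, w} p).1 ⟨A⟩ = 0 ∨ (ofBeta.{u, w} p).1 ⟨A⟩ = 1 := by
  have hcl : IsClosed {p : Beta Y | (ofBeta.{u, w} p).1 ⟨A⟩ ∈ ({0, 1} : Set ℝ)} :=
    (Set.toFinite _).isClosed.preimage ((continuous_eval A).comp continuous_ofBeta)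
  refine denseRange_unit.induction_on p hcl fun y => ?_
  rw [ofBeta_unit, dirac_apply]
  by_cases hy : y ∈ A <;> simp [hy]

/-- Disjoint neighbourhoods `U` of `p` and `W` of `q` separate the images: the trace of `U` on `Y`
has mass 1 under `p` and 0 under `q`. -/
theorem injective_ofBeta : Function.Injective (ofBeta.{u, w} (Y := Y)) := by
  intro p q hpq
  by_contra hne
  obtain ⟨U, W, hU, hW, hp, hq, hd⟩ := t2_separation hne
  have key : ∀ (r : Beta Y) (O : Set (Beta Y)) (c : ℝ), IsOpen O → r ∈ O →
      (∀ y, Beta.unit y ∈ O → (dirac.{u, w} y).1 ⟨Beta.unit ⁻¹' U⟩ = c) →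
      (ofBeta.{u, w} r).1 ⟨Beta.unit ⁻¹' U⟩ = c := by
    intro r O c hO hr h
    have hcl : IsClosed {r : Beta Y | (ofBeta.{u, w} r).1 ⟨Beta.unit ⁻¹' U⟩ = c} :=
      isClosed_singleton.preimage ((continuous_eval _).comp continuous_ofBeta)
    refine closure_minimal ?_ hcl (denseRange_unit.open_subset_closure_inter hO hr)
    rintro _ ⟨hy, y, rfl⟩
    rw [Set.mem_ofPred_eq, ofBeta_unit]
    exact h y hy
  have h1 := key p U 1 hU hp fun y hy => by
    rw [dirac_apply, Set.indicator_of_mem (by exact hy)]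
  have h0 := key q W 0 hW hq fun y hy => by
    rw [dirac_apply, Set.indicator_of_notMem]
    exact fun hy' => Set.disjoint_left.1 hd hy' hy
  rw [hpq, h0] at h1
  exact zero_ne_one h1

theorem range_ofBeta : Set.range (ofBeta.{u, w} (Y := Y)) =
    {μ | μ.1 ∈ (finAddProb.{u, w} Y).extremePoints ℝ} := by
  ext μ
  rw [Set.mem_ofPred_eq, mem_extremePoints_iff]
  constructor
  · rintro ⟨p, rfl⟩ A
    exact ofBeta_apply_eq_zero_or_one p A
  · intro h
    have hcl : IsClosed (Set.range fun p : Beta Y => (ofBeta.{u, w} p).1) :=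
      (isCompact_range (continuous_subtype_val.comp continuous_ofBeta)).isClosed
    have hμ : μ.1 ∈ closure (Set.range fun p : Beta Y => (ofBeta.{u, w} p).1) := by
      refine mem_closure_of_forall_finset fun I => ?_
      -- The sets of mass 1 are closed under finite intersections, so some `y` lies in exactly those
      -- members of `I` that have mass 1; its point mass agrees with `μ` on `I`.
      have hB : μ.1 ⟨⋂ A ∈ I, {y | y ∈ A.down ↔ μ.1 A = 1}⟩ = 1 := by
        classical
        induction I using Finset.induction_on with
        | empty => simpa using μ.2.2.1
        | insert A s _ ih =>
          rw [Finset.set_biInter_insert]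
          set C := ⋂ A ∈ s, {y | y ∈ A.down ↔ μ.1 A = 1}
          have h1 : μ.1 ⟨{y | y ∈ A.down ↔ μ.1 A = 1}⟩ = 1 := by
            rcases h A.down with h0 | h0
            · have : {y | y ∈ A.down ↔ μ.1 A = 1} = A.downᶜ := by
                ext y
                change (y ∈ A.down ↔ μ.1 ⟨A.down⟩ = 1) ↔ _
                simp [h0]
              rw [this, apply_compl, h0, sub_zero]
            · have : {y | y ∈ A.down ↔ μ.1 A = 1} = A.down := by
                ext y
                change (y ∈ A.down ↔ μ.1 ⟨A.down⟩ = 1) ↔ _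
                simp [h0]
              rw [this, h0]
          rcases h ({y | y ∈ A.down ↔ μ.1 A = 1} ∩ C) with h0 | h0
          · have h2 := apply_mono μ (A := C \ ({y | y ∈ A.down ↔ μ.1 A = 1} ∩ C))
              (B := {y | y ∈ A.down ↔ μ.1 A = 1}ᶜ) (fun y hy hy' => hy.2 ⟨hy', hy.1⟩)
            have h3 := μ.2.2.2 ({y | y ∈ A.down ↔ μ.1 A = 1} ∩ C)
              (C \ ({y | y ∈ A.down ↔ μ.1 A = 1} ∩ C)) Set.disjoint_sdiff_right
            rw [Set.union_sdiff_cancel Set.inter_subset_right, ih] at h3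
            rw [apply_compl, h1] at h2
            linarith
          · exact h0
      obtain ⟨y, hy⟩ : (⋂ A ∈ I, {y | y ∈ A.down ↔ μ.1 A = 1}).Nonempty := by
        by_contra hne
        rw [Set.not_nonempty_iff_eq_empty] at hne
        rw [hne, apply_empty] at hB
        exact zero_ne_one hB
      refine ⟨_, ⟨Beta.unit y, rfl⟩, fun A hA => ?_⟩
      have hy' : y ∈ A.down ↔ μ.1 A = 1 := Set.mem_iInter₂.1 hy A hA
      dsimp only
      rw [ofBeta_unit]
      change A.down.indicator (fun _ => (1 : ℝ)) y = _
      rcases h A.down with h0 | h0 <;> change μ.1 A = _ at h0 <;> rw [h0] at hy' ⊢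
      · exact Set.indicator_of_notMem (by simpa using hy') _
      · exact Set.indicator_of_mem (by simpa using hy') _
    rw [hcl.closure_eq] at hμ
    obtain ⟨p, hp⟩ := hμ
    exact ⟨p, Subtype.ext hp⟩

end Beta

/-! ### The flow of measures on a `G`-set -/

section Flow

variable (G : Type v) [Group G] (Y : Type u) [MulAction G Y]

instance : MulAction G (finAddProb.{u, w} Y) where
  smul g := push fun y => g • y
  one_smul μ := by
    refine Subtype.ext (funext fun A => ?_)
    change μ.1 ⟨(fun y => (1 : G) • y) ⁻¹' A.down⟩ = μ.1 A
    simp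
  mul_smul g h μ := by
    refine Subtype.ext (funext fun A => ?_)
    change μ.1 ⟨(fun y => (g * h) • y) ⁻¹' A.down⟩ =
      μ.1 ⟨(fun y => h • y) ⁻¹' ((fun y => g • y) ⁻¹' A.down)⟩
    simp only [mul_smul]
    rfl

/-- The affine flow of finitely additive probability measures on a `G`-set. -/
def flow : AffineFlow.{v, max u w} G where
  V := ULift.{w} (Set Y) → ℝ
  carrier := finAddProb.{u, w} Y
  convex := convex Y
  isCompact := isCompact Y
  continuous_act g := continuous_push fun y => g • y
  affine_act g := preservesConvexComb_push fun y => g • y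

variable {G Y}

theorem smul_dirac (g : G) (y : Y) : g • dirac.{u, w} y = dirac (g • y) := rfl

theorem ofBeta_smul (g : G) (p : Beta Y) : ofBeta.{u, w} (g • p) = g • ofBeta p := by
  have : (fun p : Beta Y => ofBeta.{u, w} (g • p)) = fun p => g • ofBeta p := by
    refine Beta.hom_ext (continuous_ofBeta.comp (Beta.continuous_smul g))
      ((continuous_push fun y => g • y).comp continuous_ofBeta) fun y => ?_
    rw [Beta.smul_unit, ofBeta_unit, ofBeta_unit, smul_dirac]
  exact congrFun this p

/-- The extremal points of the flow of finitely additive probability measures are the points of the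
Stone–Čech compactification. -/
theorem exists_homeomorph_ext :
    ∃ φ : (flow.{u, v, w} G Y).ext ≃ₜ Beta Y, ∀ (g : G) x, φ (g • x) = g • φ x := by
  let f : Beta Y → (flow.{u, v, w} G Y).ext := fun p =>
    ⟨ofBeta.{u, w} p, (range_ofBeta.{u, w} (Y := Y)).subset ⟨p, rfl⟩⟩
  have hf : Continuous f := continuous_ofBeta.subtype_mk _
  have hbij : Function.Bijective f := by
    refine ⟨fun p q h => injective_ofBeta.{u, w} (congrArg Subtype.val h), fun x => ?_⟩
    obtain ⟨p, hp⟩ := (range_ofBeta.{u, w} (Y := Y)).superset x.2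
    exact ⟨p, Subtype.ext hp⟩
  let e := hf.homeoOfEquivCompactToT2 (f := Equiv.ofBijective f hbij)
  refine ⟨e.symm, fun g x => ?_⟩
  rw [Homeomorph.symm_apply_eq]
  obtain ⟨p, rfl⟩ := e.surjective x
  rw [Homeomorph.symm_apply_apply]
  exact Subtype.ext (ofBeta_smul.{u, v, w} g p).symm

end Flow

/-! ### Invariant measures and amenability -/

section Invariant

/-- The uniform probability measure on a nonempty finite set. -/
noncomputable def uniform {Y : Type u} (s : Finset Y) (hs : s.Nonempty) : finAddProb.{u, w} Y :=
  ⟨∑ x ∈ s, (s.card : ℝ)⁻¹ • (dirac.{u, w} x).1, (convex Y).sum_mem (fun _ _ => by positivity)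
    (by simp [hs.card_ne_zero]) fun x _ => (dirac x).2⟩

theorem push_uniform {Y : Type u} {Z : Type v} (e : Y ↪ Z) (s : Finset Y) (hs : s.Nonempty) :
    push.{u, v, w} e (uniform s hs) = uniform (s.map e) (hs.map) := by
  refine Subtype.ext (funext fun A => ?_)
  change (∑ x ∈ s, (s.card : ℝ)⁻¹ • (dirac.{u, w} x).1) ⟨e ⁻¹' A.down⟩ =
    (∑ x ∈ s.map e, ((s.map e).card : ℝ)⁻¹ • (dirac.{v, w} x).1) A
  rw [Finset.sum_map, Finset.card_map, Finset.sum_apply, Finset.sum_apply]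
  rfl

theorem isAmenableGroup_of_push {H : Type u} [Group H] (ν : finAddProb.{u, w} H)
    (h : ∀ h : H, push (fun x => h * x) ν = ν) : IsAmenableGroup H := by
  refine ⟨fun A => ν.1 ⟨A⟩, fun A => ν.2.1 _, ν.2.2.1, ν.2.2.2, fun g A => ?_⟩
  have := congrArg (fun μ : finAddProb.{u, w} H => μ.1 ⟨(fun x => g * x) '' A⟩) (h g)
  rw [push_apply, Set.preimage_image_eq _ (mul_right_injective g)] at this
  exact this.symm

/-- An invariant measure on an `H`-set with an equivariant map to finitely additive measures on `H`
yields amenability. -/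
theorem isAmenableGroup_of_equivariant {H : Type u} [Group H] {Y : Type v} (σ : H → Y → Y)
    (φ : Y → finAddProb.{u, w} H) (hφ : ∀ h y, φ (σ h y) = push (fun x => h * x) (φ y))
    (μ : finAddProb.{v, w} Y) (hμ : ∀ h, push (σ h) μ = μ) : IsAmenableGroup H := by
  obtain ⟨E, hE, hE', hd⟩ := exists_extension.{v, w} (isCompact H) (convex H) φ
  refine isAmenableGroup_of_push (E μ) fun h => ?_
  -- `E` inherits equivariance from `φ`, as both sides are continuous, affine and equal at point
  -- masses.
  have key : (fun μ => push (fun x => h * x) (E μ)) = fun μ => E (push (σ h) μ) := by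
    refine hom_ext ((continuous_push _).comp hE) (hE.comp (continuous_push _)) ?_ ?_ fun y => ?_
    · exact fun x y z a b ha hb hab h =>
        preservesConvexComb_push _ _ _ _ a b ha hb hab (hE' x y z a b ha hb hab h)
    · exact fun x y z a b ha hb hab h =>
        hE' _ _ _ a b ha hb hab (preservesConvexComb_push _ x y z a b ha hb hab h)
    · rw [push_dirac, hd, hd, hφ]
  rw [congrFun key μ, hμ]

variable {J : Type u} {H : Type v} [Group J] [Group H]

/-- If `H` is not amenable, the only `H`-invariant finitely additive probability measure on
`⊕_H J` is the point mass at the identity. -/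
theorem eq_dirac_one_of_shift_invariant (hH : ¬ IsAmenableGroup H)
    (μ : finAddProb.{max u v, w} (RestrictedPower J H))
    (hμ : ∀ h : H, push (fun f => shiftAut J H h f) μ = μ) : μ = dirac 1 := by
  have h0 : μ.1 ⟨{1}ᶜ⟩ = 0 := by
    by_contra hne
    have hpos : 0 < μ.1 ⟨{1}ᶜ⟩ := lt_of_le_of_ne (μ.2.1 _) (Ne.symm hne)
    let Y := {f : RestrictedPower J H // f ≠ 1}
    -- `ν` is `μ` conditioned on the nonidentity elements, a shift-invariant set.
    let ν : finAddProb.{max u v, w} Y :=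
      ⟨fun B => μ.1 ⟨Subtype.val '' B.down⟩ / μ.1 ⟨{1}ᶜ⟩, fun B => div_nonneg (μ.2.1 _) hpos.le,
        by
          change μ.1 ⟨Subtype.val '' Set.univ⟩ / μ.1 ⟨{1}ᶜ⟩ = 1
          rw [Set.image_univ, show Set.range (Subtype.val : Y → _) = {1}ᶜ from Subtype.range_coe]
          exact div_self hpos.ne',
        fun A B h => by
          simp only [Set.image_union]
          rw [μ.2.2.2 _ _ (Set.disjoint_image_of_injective Subtype.val_injective h), add_div]⟩
    let σ : H → Y → Y := fun h y => ⟨shiftAut J H h y.1, by simpa using y.2⟩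
    have hν : ∀ h, push (σ h) ν = ν := by
      intro h
      refine Subtype.ext (funext fun B => ?_)
      change μ.1 ⟨Subtype.val '' ((σ h) ⁻¹' B.down)⟩ / _ = μ.1 ⟨Subtype.val '' B.down⟩ / _
      rw [show μ.1 ⟨Subtype.val '' B.down⟩ =
        μ.1 ⟨(fun f => shiftAut J H h f) ⁻¹' (Subtype.val '' B.down)⟩ from
        (congrArg (fun μ => μ.1 ⟨Subtype.val '' B.down⟩) (hμ h)).symm]
      refine congrArg (fun A => μ.1 ⟨A⟩ / μ.1 ⟨{1}ᶜ⟩) (Set.ext fun f => ?_)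
      constructor
      · rintro ⟨y, hy, rfl⟩
        exact ⟨_, hy, rfl⟩
      · rintro ⟨y, hy, he⟩
        have hf : f ≠ 1 := by
          rintro rfl
          exact y.2 (he.trans (map_one _))
        refine ⟨⟨f, hf⟩, ?_, rfl⟩
        change σ h ⟨f, hf⟩ ∈ B.down
        rwa [show σ h ⟨f, hf⟩ = y from Subtype.ext he.symm]
    have hfin : ∀ y : Y, (Function.mulSupport y.1.1).Finite := fun y => y.1.2
    let s : Y → Finset H := fun y => (hfin y).toFinset
    have mem_s : ∀ y x, x ∈ s y ↔ y.1.1 x ≠ 1 := fun y x => (hfin y).mem_toFinset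
    have hs : ∀ y, (s y).Nonempty := fun y => by
      exact (hfin y).toFinset_nonempty.2
        (Function.mulSupport_nonempty_iff.2 fun h => y.2 (Subtype.ext h))
    -- Shifting `f` by `h` translates its support by `h`, hence also the uniform measure on it.
    have hσ : ∀ h y, s (σ h y) = (s y).map (mulLeftEmbedding h) := by
      intro h y
      ext x
      simp only [mem_s, Finset.mem_map, mulLeftEmbedding_apply]
      change y.1.1 (h⁻¹ * x) ≠ 1 ↔ _
      constructor
      · exact fun hx => ⟨h⁻¹ * x, hx, by simp⟩
      · rintro ⟨a, ha, rfl⟩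
        simpa using ha
    refine hH (isAmenableGroup_of_equivariant σ (fun y => uniform.{v, w} (s y) (hs y)) ?_ ν hν)
    intro h y
    refine Eq.trans ?_ (push_uniform.{v, v, w} (mulLeftEmbedding h) (s y) (hs y)).symm
    simp only [hσ]
  refine Subtype.ext (funext fun ⟨A⟩ => ?_)
  rw [dirac_apply]
  have h1 := apply_compl μ {1}
  by_cases hA : (1 : RestrictedPower J H) ∈ A
  · rw [Set.indicator_of_mem hA]
    have := apply_mono μ (Set.singleton_subset_iff.2 hA)
    linarith [apply_le_one μ A]
  · rw [Set.indicator_of_notMem hA]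
    have := apply_mono μ (Set.subset_compl_singleton_iff.2 hA)
    linarith [μ.2.1 ⟨A⟩]

end Invariant

end finAddProb

/-! ### Morphisms of affine flows -/

theorem PreservesConvexComb.comp {U V W : Type*} [AddCommGroup U] [Module ℝ U] [AddCommGroup V]
    [Module ℝ V] [AddCommGroup W] [Module ℝ W] {K : Set U} {L : Set V} {M : Set W} {g : L → M}
    {f : K → L} (hg : PreservesConvexComb g) (hf : PreservesConvexComb f) :
    PreservesConvexComb (g ∘ f) :=
  fun x y z a b ha hb hab h => hg _ _ _ a b ha hb hab (hf x y z a b ha hb hab h)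

namespace AffineFlow

variable {G : Type u} [Group G]

theorem IsMorphism.map_fixedBy {K : AffineFlow.{u, v} G} {L : AffineFlow.{u, w} G}
    {f : K.carrier → L.carrier} (hf : IsMorphism K L f) {H : Subgroup G} {x : K.carrier}
    (hx : x ∈ K.fixedBy H) : f x ∈ L.fixedBy H := fun h hh => by
  rw [← hf.2.2, hx h hh]

/-- A morphism to an irreducible flow is onto as soon as the source has an `H`-fixed point. -/
theorem IsMorphism.surjective {K : AffineFlow.{u, v} G} {L : AffineFlow.{u, w} G}
    {f : K.carrier → L.carrier} (hf : IsMorphism K L f) {H : Subgroup G}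
    (hK : (K.fixedBy H).Nonempty) (hL : L.IsIrreducible H) : Function.Surjective f := by
  have : CompactSpace K.carrier := isCompact_iff_compactSpace.1 K.isCompact
  rw [← Set.range_eq_univ]
  refine hL.2 _ (isCompact_range hf.1).isClosed ?_ ?_ ?_
  · rintro _ ⟨_, ⟨x, rfl⟩, rfl⟩ _ ⟨_, ⟨y, rfl⟩, rfl⟩ a b ha hb hab
    exact ⟨_, ⟨⟨_, K.convex x.2 y.2 ha hb hab⟩, rfl⟩, hf.2.1 x y _ a b ha hb hab rfl⟩
  · rintro g _ ⟨x, rfl⟩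
    exact ⟨g • x, hf.2.2 g x⟩
  · obtain ⟨x, hx⟩ := hK
    exact ⟨f x, ⟨x, rfl⟩, hf.map_fixedBy hx⟩

theorem mem_ext_of_symm {K : AffineFlow.{u, v} G} {L : AffineFlow.{u, w} G}
    (e : K.carrier ≃ₜ L.carrier) (he : PreservesConvexComb e.symm) {x : K.carrier}
    (hx : x ∈ K.ext) : e x ∈ L.ext := by
  refine ⟨(e x).2, fun y hy z hz ⟨a, b, ha, hb, hab, h⟩ => ?_⟩
  have h1 := he ⟨y, hy⟩ ⟨z, hz⟩ (e x) a b ha.le hb.le hab h.symm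
  rw [e.symm_apply_apply] at h1
  have h2 := hx.2 (e.symm ⟨y, hy⟩).2 (e.symm ⟨z, hz⟩).2 ⟨a, b, ha, hb, hab, h1.symm⟩
  rw [← e.symm_apply_eq.1 (Subtype.ext h2)]

/-- An equivariant homeomorphism that is affine in both directions restricts to the extremal
points. -/
theorem exists_homeomorph_ext {K : AffineFlow.{u, v} G} {L : AffineFlow.{u, w} G}
    (e : K.carrier ≃ₜ L.carrier) (he : PreservesConvexComb e) (he' : PreservesConvexComb e.symm)
    (hg : ∀ (g : G) x, e (g • x) = g • e x) :
    ∃ φ : K.ext ≃ₜ L.ext, ∀ (g : G) x, φ (g • x) = g • φ x :=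
  ⟨{ toFun := fun x => ⟨e x, mem_ext_of_symm e he' x.2⟩
     invFun := fun x => ⟨e.symm x, mem_ext_of_symm e.symm he x.2⟩
     left_inv := fun x => Subtype.ext (e.symm_apply_apply x)
     right_inv := fun x => Subtype.ext (e.apply_symm_apply x)
     continuous_toFun := (e.continuous.comp continuous_subtype_val).subtype_mk _
     continuous_invFun := (e.symm.continuous.comp continuous_subtype_val).subtype_mk _ },
    fun g x => Subtype.ext (hg g x)⟩

end AffineFlow

/-! ### Irreducibility and universality of the flow of measures -/

namespace WreathProduct

open finAddProb

variable {J : Type u} {H : Type v} [Group J] [Group H]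

/-- The affine flow of finitely additive probability measures on `⊕_H J`. -/
abbrev measureFlow (J : Type u) (H : Type v) [Group J] [Group H] :
    AffineFlow.{max u v, max u v w} (WreathProduct J H) :=
  flow.{max u v, max u v, w} (WreathProduct J H) (RestrictedPower J H)

theorem smul_def (g : WreathProduct J H) (f : RestrictedPower J H) :
    g • f = g.left * shiftAut J H g.right f := rfl

theorem dirac_one_mem_fixedBy :
    dirac 1 ∈ (measureFlow.{u, v, w} J H).fixedBy (base J H) := by
  rintro _ ⟨h, rfl⟩
  refine (smul_dirac _ _).trans (congrArg dirac ?_)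
  simp [smul_def]

theorem eq_dirac_one_of_mem_fixedBy (hH : ¬ IsAmenableGroup H)
    {μ : (measureFlow.{u, v, w} J H).carrier}
    (hμ : μ ∈ (measureFlow.{u, v, w} J H).fixedBy (base J H)) : μ = dirac 1 := by
  refine eq_dirac_one_of_shift_invariant hH μ fun h => ?_
  refine Eq.trans (congrArg (fun e => push e μ) (funext fun f => ?_))
    (hμ (SemidirectProduct.inr h) ⟨h, rfl⟩)
  simp [smul_def]

theorem inl_smul_dirac_one (f : RestrictedPower J H) :
    (SemidirectProduct.inl f : WreathProduct J H) •
      dirac.{max u v, w} (1 : RestrictedPower J H) = dirac f := by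
  rw [smul_dirac, smul_def]
  simp

/-- The `H`-fixed point in `L` must be `δ_1`, and `⊕_H J` carries it to every point mass. -/
theorem isIrreducible_measureFlow (hH : ¬ IsAmenableGroup H) :
    (measureFlow.{u, v, w} J H).IsIrreducible (base J H) := by
  refine ⟨⟨_, dirac_one_mem_fixedBy⟩, fun L hL hconv hinv ⟨μ, hμ, hfix⟩ => ?_⟩
  refine eq_univ_of_dirac_mem hL hconv fun f => ?_
  obtain rfl := eq_dirac_one_of_mem_fixedBy hH hfix
  rw [← inl_smul_dirac_one]
  exact hinv _ _ hμ

theorem exists_morphism_measureFlow {L : AffineFlow.{max u v, w'} (WreathProduct J H)}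
    (hL : (L.fixedBy (base J H)).Nonempty) :
    ∃ E, AffineFlow.IsMorphism (measureFlow.{u, v, w} J H) L E := by
  obtain ⟨l, hl⟩ := hL
  obtain ⟨E, hE, hE', hd⟩ := exists_extension.{max u v, w} L.isCompact L.convex
    fun f : RestrictedPower J H => (SemidirectProduct.inl f : WreathProduct J H) • l
  refine ⟨E, hE, hE', fun g => congrFun ?_⟩
  refine hom_ext (hE.comp (continuous_push _)) ((L.continuous_act g).comp hE)
    (hE'.comp (preservesConvexComb_push _)) ((L.affine_act g).comp hE') fun f => ?_
  change E (dirac (g • f)) = g • E (dirac f)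
  rw [hd, hd, ← mul_smul]
  -- `g • f` represents the coset of `g * inl f` modulo `H`, and the remaining `H`-factor fixes `l`.
  have : (SemidirectProduct.inl (g • f) : WreathProduct J H) * SemidirectProduct.inr g.right =
      g * SemidirectProduct.inl f := by
    ext <;> simp [smul_def]
  rw [← this, mul_smul, hl _ ⟨g.right, rfl⟩]

theorem isUniversal_measureFlow (hH : ¬ IsAmenableGroup H) :
    (measureFlow.{u, v, w} J H).IsUniversal (base J H) := by
  refine ⟨isIrreducible_measureFlow hH, fun L hL => ?_⟩
  obtain ⟨E, hE⟩ := exists_morphism_measureFlow.{u, v, w, max u v w} hL.1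
  exact ⟨E, hE, hE.surjective ⟨_, dirac_one_mem_fixedBy⟩ hL⟩

/-- An irreducible flow that maps to the flow of measures is isomorphic to it. -/
theorem exists_homeomorph_measureFlow (hH : ¬ IsAmenableGroup H)
    {K : AffineFlow.{max u v, w'} (WreathProduct J H)} (hK : K.IsIrreducible (base J H))
    {f : K.carrier → (measureFlow.{u, v, w} J H).carrier}
    (hf : AffineFlow.IsMorphism K (measureFlow.{u, v, w} J H) f) :
    ∃ e : K.carrier ≃ₜ (measureFlow.{u, v, w} J H).carrier, PreservesConvexComb e ∧
      PreservesConvexComb e.symm ∧ ∀ (g : WreathProduct J H) x, e (g • x) = g • e x := by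
  obtain ⟨E, hE⟩ := exists_morphism_measureFlow.{u, v, w, w'} hK.1
  have hfE : ∀ μ, f (E μ) = μ := congrFun <| by
    refine hom_ext (hf.1.comp hE.1) continuous_id (hf.2.1.comp hE.2.1)
      (fun _ _ _ _ _ _ _ _ h => h) fun y => ?_
    -- `f ∘ E` sends the `H`-fixed point `δ_1` to an `H`-fixed point, hence to itself; by
    -- equivariance it fixes all point masses.
    have h1 : f (E (dirac 1)) = dirac 1 := eq_dirac_one_of_mem_fixedBy hH
      (hf.map_fixedBy (hE.map_fixedBy dirac_one_mem_fixedBy))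
    change f (E (dirac y)) = dirac y
    rw [← inl_smul_dirac_one]
    refine (congrArg f (hE.2.2 _ _)).trans ((hf.2.2 _ _).trans ?_)
    rw [h1]
    rfl
  -- Irreducibility of `K` makes `E` onto, so its left inverse `f` is two-sided.
  have hEf : ∀ x, E (f x) = x := fun x => by
    obtain ⟨μ, rfl⟩ := hE.surjective ⟨_, dirac_one_mem_fixedBy⟩ hK x
    rw [hfE]
  exact ⟨⟨⟨f, E, hEf, hfE⟩, hf.1, hE.1⟩, hf.2.1, hE.2.1, hf.2.2⟩

end WreathProduct

theorem corollary1p14 (J : Type u) (H : Type v) [Group J] [Group H] (hH : ¬ IsAmenableGroup H) :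
    (∃ K : AffineFlow.{max u v, max u v w} (WreathProduct J H),
      K.IsUniversal (WreathProduct.base J H)) ∧
    ∀ K : AffineFlow.{max u v, max u v w} (WreathProduct J H),
      K.IsUniversal (WreathProduct.base J H) →
      ∃ φ : K.ext ≃ₜ Beta (RestrictedPower J H),
        ∀ (g : WreathProduct J H) (x : K.ext), φ (g • x) = g • φ x := by
  have hU := WreathProduct.isUniversal_measureFlow.{u, v, w} (J := J) hH
  refine ⟨⟨_, hU⟩, fun K hK => ?_⟩
  obtain ⟨f, hf, -⟩ := hK.2 _ hU.1
  obtain ⟨e, he, he', hg⟩ := WreathProduct.exists_homeomorph_measureFlow hH hK.1 hf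
  obtain ⟨φ, hφ⟩ := AffineFlow.exists_homeomorph_ext e he he' hg
  obtain ⟨ψ, hψ⟩ := finAddProb.exists_homeomorph_ext.{max u v, max u v, w}
    (G := WreathProduct J H) (Y := RestrictedPower J H)
  exact ⟨φ.trans ψ, fun g x => (congrArg ψ (hφ g x)).trans (hψ g _)⟩
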